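/- Let $m\ge 1$ be an integer and let $p_0,\dots,p_{m-1}\in(0,1)$, $q_i=1-p_i$, with indices read modulo $m$. Let $(S_n)_{n\ge 0}$ be a random walk $G(m,\mathbf p)$, that is, a Markov chain on $\mathbb Z$ with an arbitrary initial distribution which from a state $i$ moves to $i+1$ with probability $p_{i \bmod m}$ and to $i-1$ with probability $q_{i\bmod m}$. Let $C$ be the $m\times m$ transition matrix of the cyclic chain $(S_n \bmod m)_{n\ge0}$ on $\mathbb Z/m\mathbb Z$, which moves from $i$ to $i+1$ with probability $p_i$ and from $i$ to $i-1$ with probability $q_i$ (the two probabilities are added if $i+1\equiv i-1 \pmod m$). Let $\gamma_{im}$, $1\le i\le m$, be the $i$-th diagonal cofactor of $I-C$ (the one belonging to the state $i-1$), and let $\gamma_{\cdot m}=\gamma_{1m}+\dots+\gamma_{mm}$. Then $\gamma_{\cdot m}>0$, the matrix $C$ has exactly one stationary probability vector $\boldsymbol\pi_m=(\pi_0,\dots,\pi_{m-1})$, it is given by $\pi_{i-1}=\gamma_{im}/\gamma_{\cdot m}$ for $1\le i\le m$, and, with $\mathbf b=(p_0-q_0,\dots,p_{m-1}-q_{m-1})$,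 almost surely $$\lim_{n\to\infty}\frac{S_n}{n}=\lambda_m:=\boldsymbol\pi_m\cdot\mathbf b=\frac1{\gamma_{\cdot m}}\sum_{i=1}^m\gamma_{im}\,(p_{i-1}-q_{i-1}).$$ This holds for every $m\ge1$, odd or even. -/

import Mathlib

open MeasureTheory Filter Topology

/-- One-step transition probabilities `i → j` of the walk on `ℤ` which, from the state `i`, moves
to `i + 1` with probability `p (i mod m)` and to `i - 1` with probability `1 - p (i mod m)`. -/
noncomputable def walkStep (m : ℕ) (p : ZMod m → ℝ) (i j : ℤ) : ℝ :=
  if j = i + 1 then p (i : ZMod m) else if j = i - 1 then 1 - p (i : ZMod m) else 0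

/-- `S` is, under `P`, a realization of the game `G(m, p)`: a Markov chain on `ℤ` with transition
probabilities `walkStep m p` and an arbitrary initial distribution. The Markov property is written
without division: the probability of a path of length `n + 1` is the probability of its first part
times the transition probability of its last step. -/
structure IsGame (m : ℕ) (p : ZMod m → ℝ) {Ω : Type*} [MeasurableSpace Ω]
    (P : Measure Ω) (S : ℕ → Ω → ℤ) : Prop where
  measurable : ∀ n, Measurable (S n)
  markov : ∀ (n : ℕ) (s : ℕ → ℤ),
    P.real {ω | ∀ k ≤ n + 1, S k ω = s k} =
      P.real {ω | ∀ k ≤ n, S k ω = s k} * walkStep m p (s n) (s (n + 1))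

/-- The transition matrix `C` of the chain of congruence classes of the walk: from the class `i` to
`i + 1` with probability `p i` and to `i - 1` with probability `1 - p i`. The two terms are added,
since the classes `i + 1` and `i - 1` coincide for `m ≤ 2`. -/
noncomputable def cyclicChain (m : ℕ) (p : ZMod m → ℝ) : Matrix (ZMod m) (ZMod m) ℝ :=
  Matrix.of fun i j => (if j = i + 1 then p i else 0) + (if j = i - 1 then 1 - p i else 0)

/-- The vector `b` of expected one-step gains, `b i = p i - q i` with `q i = 1 - p i`. -/
def meanGain (m : ℕ) (p : ZMod m → ℝ) : ZMod m → ℝ :=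
  fun i => p i - (1 - p i)

/-- The `i`-th diagonal cofactor of `I - C`. -/
noncomputable def diagCofactor (m : ℕ) [NeZero m] (p : ZMod m → ℝ) (i : ZMod m) : ℝ :=
  (1 - cyclicChain m p).adjugate i i

/-- `v` is a stationary probability (row) vector of the transition matrix `C`. -/
def IsStationaryVector {ι : Type*} [Fintype ι] (C : Matrix ι ι ℝ) (v : ι → ℝ) : Prop :=
  (∀ i, 0 ≤ v i) ∧ ∑ i, v i = 1 ∧ Matrix.vecMul v C = v

/-! Let `h` solve the Poisson equation `(I - C) h = b - λ` (`exists_poisson_solution`). Then `W i =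
i + h (i mod m)` gains exactly `λ` on average at each step, so `W (S n) - W (S 0) - n λ` is a
martingale with bounded increments. Exponential moments and Borel–Cantelli make it `o(n)` almost
surely; as `h` is bounded, `S n / n → λ`. Periodicity of the chain is irrelevant, hence so is the
parity of `m`.

The linear algebra rests on the maximum principle: the kernel of `I - C` consists of the constants.
This gives solvability of the Poisson equation, uniqueness of the stationary vector, and its formula
through the adjugate; a homotopy gives positivity of the cofactors. -/

/-! ### Cofactors and stationary vector of the cyclic chain -/

open Matrix in
theorem cyclicChain_mulVec (m : ℕ) [NeZero m] (p x : ZMod m → ℝ) (i : ZMod m) :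
    (cyclicChain m p *ᵥ x) i = p i * x (i + 1) + (1 - p i) * x (i - 1) := by
  simp [cyclicChain, Matrix.mulVec, dotProduct, add_mul, Finset.sum_add_distrib]

/-- Maximum principle: a function that is subharmonic for the cyclic chain off the state `i₀`
attains its maximum at `i₀`. -/
theorem le_of_subharmonic_off {m : ℕ} [NeZero m] {p : ZMod m → ℝ} (hp : ∀ i, 0 < p i ∧ p i < 1)
    {y : ZMod m → ℝ} {i₀ : ZMod m}
    (hy : ∀ j, j ≠ i₀ → y j ≤ p j * y (j + 1) + (1 - p j) * y (j - 1)) (j : ZMod m) :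
    y j ≤ y i₀ := by
  obtain ⟨a, ha⟩ := Finite.exists_max y
  suffices h : y i₀ = y a from h ▸ ha j
  -- Walking upwards from a maximiser `a`, the maximum propagates until `i₀` is met, which happens
  -- within `(i₀ - a).val` steps.
  have key : ∀ k : ℕ, y (a + k) = y a ∨ y i₀ = y a := by
    intro k
    induction k with
    | zero => simp
    | succ k ih =>
      rcases ih with ih | ih
      · by_cases hk : a + k = i₀
        · right; rw [← hk, ih]
        · left
          have h1 := hy _ hk
          have h2 := ha (a + k + 1)
          have h3 := ha (a + k - 1)
          obtain ⟨h4, h5⟩ := hp (a + k)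
          push_cast
          rw [← add_assoc]
          refine le_antisymm h2 ?_
          rw [ih] at h1
          have h6 : (1 - p (a + k)) * y (a + k - 1) ≤ (1 - p (a + k)) * y a :=
            mul_le_mul_of_nonneg_left h3 (by linarith)
          have h7 : p (a + k) * y a ≤ p (a + k) * y (a + k + 1) := by linarith
          exact le_of_mul_le_mul_left h7 h4
      · exact Or.inr ih
  have h := key (i₀ - a).val
  rw [ZMod.natCast_zmod_val, add_sub_cancel] at h
  exact h.elim id id

open Matrix in
theorem eq_of_one_sub_cyclicChain_mulVec_eq_zero {m : ℕ} [NeZero m] {p : ZMod m → ℝ}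
    (hp : ∀ i, 0 < p i ∧ p i < 1) {x : ZMod m → ℝ} (hx : (1 - cyclicChain m p) *ᵥ x = 0)
    (i j : ZMod m) : x i = x j := by
  have hx' : ∀ k, x k ≤ p k * x (k + 1) + (1 - p k) * x (k - 1) := by
    intro k
    have h := congrFun hx k
    rw [Matrix.sub_mulVec, Matrix.one_mulVec, Pi.sub_apply, cyclicChain_mulVec,
      Pi.zero_apply] at h
    linarith
  exact le_antisymm (le_of_subharmonic_off hp (fun k _ => hx' k) i)
    (le_of_subharmonic_off hp (fun k _ => hx' k) j)

-- The replaced row forces a kernel vector `x` to vanish at `i`. Since `0 ≤ t ≤ 1`, `|x|` is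
-- subharmonic off `i`, so the maximum principle gives `x = 0`.
open Matrix in
theorem det_updateRow_one_sub_smul_ne_zero {m : ℕ} [NeZero m] {p : ZMod m → ℝ}
    (hp : ∀ i, 0 < p i ∧ p i < 1) (i : ZMod m) {t : ℝ} (ht : t ∈ Set.Icc (0 : ℝ) 1) :
    ((1 - t • cyclicChain m p).updateRow i (Pi.single i 1)).det ≠ 0 := by
  intro hdet
  obtain ⟨x, hx0, hx⟩ := Matrix.exists_mulVec_eq_zero_iff.mpr hdet
  apply hx0
  have hi : x i = 0 := by
    have h := congrFun hx i
    simpa [Matrix.mulVec, Matrix.updateRow_self] using h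
  have hj : ∀ j, j ≠ i → |x j| ≤ p j * |x (j + 1)| + (1 - p j) * |x (j - 1)| := by
    intro j hj
    have h := congrFun hx j
    rw [Matrix.mulVec, Matrix.updateRow_ne hj] at h
    change ((1 - t • cyclicChain m p) *ᵥ x) j = 0 at h
    rw [Matrix.sub_mulVec, Matrix.one_mulVec, Pi.sub_apply, Matrix.smul_mulVec,
      Pi.smul_apply, cyclicChain_mulVec, smul_eq_mul] at h
    obtain ⟨h4, h5⟩ := hp j
    rw [sub_eq_zero.mp h, abs_mul, abs_of_nonneg ht.1]
    have h6 : |p j * x (j + 1) + (1 - p j) * x (j - 1)| ≤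
        p j * |x (j + 1)| + (1 - p j) * |x (j - 1)| := by
      refine (abs_add_le _ _).trans (le_of_eq ?_)
      rw [abs_mul, abs_mul, abs_of_pos h4, abs_of_pos (sub_pos.mpr h5)]
    exact (mul_le_of_le_one_left (abs_nonneg _) ht.2).trans h6
  ext j
  have h := le_of_subharmonic_off (y := fun k => |x k|) hp hj j
  simpa [hi] using h

-- Deform `C` to `t • C`: the determinant is continuous in `t`, equals 1 at `t = 0` and the cofactor
-- at `t = 1`, and never vanishes between.
open Matrix in
theorem diagCofactor_pos {m : ℕ} [NeZero m] {p : ZMod m → ℝ}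
    (hp : ∀ i, 0 < p i ∧ p i < 1) (i : ZMod m) : 0 < diagCofactor m p i := by
  set f : ℝ → ℝ := fun t => ((1 - t • cyclicChain m p).updateRow i (Pi.single i 1)).det with hf
  have hcont : Continuous f := by
    refine Continuous.matrix_det (Continuous.matrix_updateRow i ?_ continuous_const)
    fun_prop
  have h0 : f 0 = 1 := by
    have : (1 : Matrix (ZMod m) (ZMod m) ℝ).updateRow i (Pi.single i 1) = 1 := by
      ext a b
      rcases eq_or_ne a i with rfl | h
      · rw [Matrix.updateRow_self, Matrix.one_eq_pi_single]
      · rw [Matrix.updateRow_ne h]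
    simp [hf, this]
  have h1 : diagCofactor m p i = f 1 := by
    simp [hf, diagCofactor, Matrix.adjugate_apply]
  rw [h1]
  by_contra! h
  obtain ⟨t, ht, hft⟩ := intermediate_value_Icc' (zero_le_one (α := ℝ)) hcont.continuousOn
    (show (0 : ℝ) ∈ Set.Icc (f 1) (f 0) from ⟨h, by rw [h0]; exact zero_le_one⟩)
  exact det_updateRow_one_sub_smul_ne_zero hp i ht hft

open Matrix in
theorem diagCofactor_vecMul {m : ℕ} [NeZero m] {p : ZMod m → ℝ}
    (hp : ∀ i, 0 < p i ∧ p i < 1) : diagCofactor m p ᵥ* cyclicChain m p = diagCofactor m p := by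
  set A := 1 - cyclicChain m p with hA
  have hdet : A.det = 0 := by
    refine Matrix.exists_mulVec_eq_zero_iff.mp ⟨1, one_ne_zero, ?_⟩
    ext i
    rw [hA, Matrix.sub_mulVec, Matrix.one_mulVec, Pi.sub_apply, cyclicChain_mulVec]
    simp
  -- As `A * adj A = 0`, the columns of the adjugate lie in the kernel of `A` and are constant; so
  -- each row is the vector of diagonal cofactors.
  have hcol : ∀ i j, A.adjugate i j = diagCofactor m p j := by
    intro i j
    refine eq_of_one_sub_cyclicChain_mulVec_eq_zero hp (x := fun k => A.adjugate k j) ?_ i j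
    ext k
    have h := congrFun (congrFun (Matrix.mul_adjugate A) k) j
    rw [hdet, zero_smul] at h
    exact h
  have h : diagCofactor m p ᵥ* A = 0 := by
    ext k
    have h := congrFun (congrFun (Matrix.adjugate_mul A) 0) k
    rw [hdet, zero_smul, Matrix.mul_apply] at h
    simp only [hcol] at h
    exact h
  rw [hA, Matrix.vecMul_sub, Matrix.vecMul_one, sub_eq_zero] at h
  exact h.symm

open Matrix in
theorem isStationaryVector_diagCofactor_div {m : ℕ} [NeZero m] {p : ZMod m → ℝ}
    (hp : ∀ i, 0 < p i ∧ p i < 1) :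
    IsStationaryVector (cyclicChain m p)
      (fun i => diagCofactor m p i / ∑ k, diagCofactor m p k) := by
  have hpos : 0 < ∑ k, diagCofactor m p k :=
    Finset.sum_pos (fun i _ => diagCofactor_pos hp i) Finset.univ_nonempty
  refine ⟨fun i => (div_pos (diagCofactor_pos hp i) hpos).le, ?_, ?_⟩
  · rw [← Finset.sum_div, div_self hpos.ne']
  · have h : (fun i => diagCofactor m p i / ∑ k, diagCofactor m p k) =
        (∑ k, diagCofactor m p k)⁻¹ • diagCofactor m p := by
      ext i
      simp [div_eq_inv_mul]
    rw [h, Matrix.smul_vecMul, diagCofactor_vecMul hp]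

/-- The Poisson equation `(I - C) h = f - c` of the cyclic chain has a solution, with `c` the mean
of `f` under the stationary vector. -/
theorem exists_poisson_solution {m : ℕ} [NeZero m] {p : ZMod m → ℝ}
    (hp : ∀ i, 0 < p i ∧ p i < 1) {v : ZMod m → ℝ}
    (hv : IsStationaryVector (cyclicChain m p) v) (f : ZMod m → ℝ) :
    ∃ h : ZMod m → ℝ, ∀ i, h i - (p i * h (i + 1) + (1 - p i) * h (i - 1)) = f i - v ⬝ᵥ f := by
  set A := 1 - cyclicChain m p with hA
  have hvA : ∀ h : ZMod m → ℝ, v ⬝ᵥ (A.mulVec h) = 0 := by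
    intro h
    rw [Matrix.dotProduct_mulVec, hA, Matrix.vecMul_sub, Matrix.vecMul_one, hv.2.2, sub_self,
      zero_dotProduct]
  have hv1 : ∀ c : ℝ, v ⬝ᵥ (fun _ => c) = c := by
    intro c
    rw [dotProduct, ← Finset.sum_mul, hv.2.1, one_mul]
  -- A rank-one term makes `A` invertible. Pairing with `v` kills the range of `A`, so `L h = f`
  -- forces `h 0 = v ⬝ᵥ f`, the required constant.
  let L : (ZMod m → ℝ) →ₗ[ℝ] (ZMod m → ℝ) :=
    A.mulVecLin + LinearMap.pi fun _ => LinearMap.proj 0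
  have hL : ∀ h, L h = A.mulVec h + fun _ => h 0 := fun h => rfl
  have hLv : ∀ h, v ⬝ᵥ L h = h 0 := by
    intro h
    rw [hL, dotProduct_add, hvA, hv1, zero_add]
  have hinj : Function.Injective L := by
    rw [← LinearMap.ker_eq_bot, LinearMap.ker_eq_bot']
    intro h hh
    have h0 : h 0 = 0 := by rw [← hLv h, hh, dotProduct_zero]
    have hAh : A.mulVec h = 0 := by
      rw [hL, h0] at hh
      exact (add_zero _).symm.trans hh
    ext i
    rw [eq_of_one_sub_cyclicChain_mulVec_eq_zero hp hAh i 0, h0, Pi.zero_apply]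
  obtain ⟨h, hh⟩ := LinearMap.surjective_of_injective hinj f
  refine ⟨h, fun i => ?_⟩
  rw [← hh, hLv, hL, Pi.add_apply, hA, Matrix.sub_mulVec, Matrix.one_mulVec, Pi.sub_apply,
    cyclicChain_mulVec]
  ring

/-- Pairing `v` with the Poisson equation built from `w` gives `v ⬝ᵥ f = w ⬝ᵥ f` for every `f`. -/
theorem IsStationaryVector.eq_of_cyclicChain {m : ℕ} [NeZero m] {p : ZMod m → ℝ}
    (hp : ∀ i, 0 < p i ∧ p i < 1) {v w : ZMod m → ℝ}
    (hv : IsStationaryVector (cyclicChain m p) v) (hw : IsStationaryVector (cyclicChain m p) w) :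
    v = w := by
  refine dotProduct_eq _ _ fun f => ?_
  obtain ⟨h, hh⟩ := exists_poisson_solution hp hw f
  have h1 : (1 - cyclicChain m p).mulVec h = f - fun _ => w ⬝ᵥ f := by
    ext i
    rw [Matrix.sub_mulVec, Matrix.one_mulVec, Pi.sub_apply, cyclicChain_mulVec, hh, Pi.sub_apply]
  have h2 : v ⬝ᵥ (1 - cyclicChain m p).mulVec h = 0 := by
    rw [Matrix.dotProduct_mulVec, Matrix.vecMul_sub, Matrix.vecMul_one, hv.2.2, sub_self,
      zero_dotProduct]
  rw [h1, dotProduct_sub, dotProduct, dotProduct, ← Finset.sum_mul, hv.2.1, one_mul] at h2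
  exact sub_eq_zero.mp h2

/-! ### Exponential moments and the law of large numbers -/

/-- One step of the walk, in integrated form: given the path up to time `n`, the next state is
`S n + 1` or `S n - 1` with the transition probabilities of the state `S n`. -/
theorem IsGame.lintegral_step {m : ℕ} {p : ZMod m → ℝ}
    {Ω : Type*} [MeasurableSpace Ω] {P : Measure Ω} [IsProbabilityMeasure P]
    {S : ℕ → Ω → ℤ} (hS : IsGame m p P S) (n : ℕ) (G : (Fin (n + 1) → ℤ) → ℤ → ENNReal) :
    ∫⁻ ω, G (fun k => S k ω) (S (n + 1) ω) ∂P =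
      ∫⁻ ω, (ENNReal.ofReal (p (S n ω : ZMod m)) * G (fun k => S k ω) (S n ω + 1) +
        ENNReal.ofReal (1 - p (S n ω : ZMod m)) * G (fun k => S k ω) (S n ω - 1)) ∂P := by
  let X : Ω → (Fin (n + 1) → ℤ) := fun ω k => S k ω
  have hX : Measurable X := measurable_pi_lambda _ fun k => hS.measurable k
  have hXS : Measurable fun ω => (X ω, S (n + 1) ω) := hX.prodMk (hS.measurable _)
  have hstep : ∀ x j, P {ω | X ω = x ∧ S (n + 1) ω = j} =
      P {ω | X ω = x} * ENNReal.ofReal (walkStep m p (x (Fin.last n)) j) := by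
    intro x j
    -- The Markov property needs a full sequence; its values beyond `n + 1` play no role.
    let s : ℕ → ℤ := fun k => if h : k ≤ n then x ⟨k, Nat.lt_succ_of_le h⟩ else j
    have h1 : {ω | ∀ k ≤ n, S k ω = s k} = {ω | X ω = x} := by
      ext ω
      constructor
      · intro h
        funext k
        have := h k (Nat.lt_succ_iff.mp k.2)
        simpa [s, X, Nat.lt_succ_iff.mp k.2] using this
      · intro h k hk
        have := congrFun h ⟨k, Nat.lt_succ_iff.mpr hk⟩
        simpa [s, X, hk] using this
    have h2 : {ω | ∀ k ≤ n + 1, S k ω = s k} = {ω | X ω = x ∧ S (n + 1) ω = j} := by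
      have h3 : ∀ ω, X ω = x ↔ ∀ k ≤ n, S k ω = s k := fun ω => (Set.ext_iff.mp h1 ω).symm
      have h4 : s (n + 1) = j := by simp [s]
      ext ω
      simp only [Set.mem_ofPred_eq, h3]
      constructor
      · exact fun h => ⟨fun k hk => h k (by omega), h4 ▸ h _ le_rfl⟩
      · rintro ⟨h, h'⟩ k hk
        rcases Nat.lt_or_eq_of_le hk with hk | rfl
        · exact h k (by omega)
        · rw [h', h4]
    have h := hS.markov n s
    rw [h1, h2] at h
    have h5 : s n = x (Fin.last n) := by simp [s, Fin.last]
    have h6 : s (n + 1) = j := by simp [s]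
    rw [h5, h6] at h
    rw [← ENNReal.ofReal_toReal (measure_ne_top P {ω | X ω = x ∧ S (n + 1) ω = j}),
      ← ENNReal.ofReal_toReal (measure_ne_top P {ω | X ω = x}),
      ← ENNReal.ofReal_mul ENNReal.toReal_nonneg]
    exact congrArg ENNReal.ofReal h
  have hL : ∫⁻ ω, G (X ω) (S (n + 1) ω) ∂P =
      ∑' x, ∑' j, G x j * P {ω | X ω = x ∧ S (n + 1) ω = j} := by
    rw [← lintegral_map (f := fun z : (Fin (n + 1) → ℤ) × ℤ => G z.1 z.2)
      (measurable_of_countable _) hXS, lintegral_countable', ENNReal.tsum_prod']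
    refine tsum_congr fun x => tsum_congr fun j => ?_
    rw [Measure.map_apply hXS (measurableSet_singleton _)]
    congr 2
    ext ω
    simp
  have hR : ∀ F : (Fin (n + 1) → ℤ) → ENNReal,
      ∫⁻ ω, F (X ω) ∂P = ∑' x, F x * P {ω | X ω = x} := by
    intro F
    rw [← lintegral_map (f := F) (measurable_of_countable _) hX, lintegral_countable']
    refine tsum_congr fun x => ?_
    rw [Measure.map_apply hX (measurableSet_singleton _)]
    rfl
  refine hL.trans (Eq.trans (tsum_congr fun x => ?_) (hR fun x =>
    ENNReal.ofReal (p (x (Fin.last n) : ZMod m)) * G x (x (Fin.last n) + 1) +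
      ENNReal.ofReal (1 - p (x (Fin.last n) : ZMod m)) * G x (x (Fin.last n) - 1)).symm)
  set i := x (Fin.last n)
  rw [tsum_eq_sum (s := {i + 1, i - 1})]
  · rw [Finset.sum_pair (by omega), hstep, hstep]
    have h1 : walkStep m p i (i + 1) = p i := by simp [walkStep]
    have h2 : walkStep m p i (i - 1) = 1 - p i := by
      rw [walkStep, if_neg (by omega), if_pos rfl]
    change G x (i + 1) * (_ * ENNReal.ofReal (walkStep m p i (i + 1))) +
      G x (i - 1) * (_ * ENNReal.ofReal (walkStep m p i (i - 1))) = _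
    rw [h1, h2]
    ring
  · intro j hj
    simp only [Finset.mem_insert, Finset.mem_singleton, not_or] at hj
    rw [hstep]
    change G x j * (_ * ENNReal.ofReal (walkStep m p i j)) = 0
    rw [walkStep, if_neg hj.1, if_neg hj.2]
    simp

/-- Use `exp u ≤ 1 + u + u ^ 2` for `|u| ≤ 1`: the linear terms cancel by centering, and `1 + x ≤
exp x` closes the bound. -/
theorem two_point_exp_le {p a b K θ : ℝ} (hp : 0 < p ∧ p < 1) (hmean : p * a + (1 - p) * b = 0)
    (ha : |a| ≤ K) (hb : |b| ≤ K) (hθ : 0 ≤ θ) (hθK : θ * K ≤ 1) :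
    p * Real.exp (θ * a) + (1 - p) * Real.exp (θ * b) ≤ Real.exp (θ ^ 2 * K ^ 2) := by
  have key : ∀ c, |c| ≤ K → Real.exp (θ * c) ≤ 1 + θ * c + θ ^ 2 * K ^ 2 := by
    intro c hc
    have h1 : |θ * c| ≤ θ * K := by
      rw [abs_mul, abs_of_nonneg hθ]
      exact mul_le_mul_of_nonneg_left hc hθ
    have h2 := (abs_le.mp (Real.abs_exp_sub_one_sub_id_le (h1.trans hθK))).2
    have h3 : (θ * c) ^ 2 ≤ (θ * K) ^ 2 := sq_le_sq' (abs_le.mp h1).1 (abs_le.mp h1).2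
    rw [← mul_pow]
    linarith
  have h1 := mul_le_mul_of_nonneg_left (key a ha) hp.1.le
  have h2 := mul_le_mul_of_nonneg_left (key b hb) (sub_pos.mpr hp.2).le
  have h3 := Real.add_one_le_exp (θ ^ 2 * K ^ 2)
  have h4 : p * (1 + θ * a + θ ^ 2 * K ^ 2) + (1 - p) * (1 + θ * b + θ ^ 2 * K ^ 2) =
      1 + θ ^ 2 * K ^ 2 + θ * (p * a + (1 - p) * b) := by ring
  rw [hmean] at h4
  linarith

/-- Exponential moment bound for the martingale `W (S n) - W (S 0) - n c` with bounded
increments. -/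
theorem IsGame.lintegral_exp_le {m : ℕ} {p : ZMod m → ℝ} (hp : ∀ i, 0 < p i ∧ p i < 1)
    {Ω : Type*} [MeasurableSpace Ω] {P : Measure Ω} [IsProbabilityMeasure P]
    {S : ℕ → Ω → ℤ} (hS : IsGame m p P S) {W : ℤ → ℝ} {c K θ : ℝ}
    (hmean : ∀ i : ℤ, p i * (W (i + 1) - W i - c) + (1 - p i) * (W (i - 1) - W i - c) = 0)
    (hup : ∀ i, |W (i + 1) - W i - c| ≤ K) (hdown : ∀ i, |W (i - 1) - W i - c| ≤ K)
    (hθ : 0 ≤ θ) (hθK : θ * K ≤ 1) (n : ℕ) :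
    ∫⁻ ω, ENNReal.ofReal (Real.exp (θ * (W (S n ω) - W (S 0 ω) - n * c))) ∂P ≤
      ENNReal.ofReal (Real.exp (n * (θ ^ 2 * K ^ 2))) := by
  induction n with
  | zero => simp
  | succ n ih =>
    have h := hS.lintegral_step n (fun x j =>
      ENNReal.ofReal (Real.exp (θ * (W j - W (x 0) - (n + 1 : ℕ) * c))))
    simp only [Fin.val_zero] at h
    rw [h]
    calc _ ≤ ∫⁻ ω, ENNReal.ofReal (Real.exp (θ ^ 2 * K ^ 2)) *
          ENNReal.ofReal (Real.exp (θ * (W (S n ω) - W (S 0 ω) - n * c))) ∂P := by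
          refine lintegral_mono fun ω => ?_
          set i := S n ω
          obtain ⟨h1, h2⟩ := hp (i : ZMod m)
          have h3 := two_point_exp_le (hp i) (hmean i) (hup i) (hdown i) hθ hθK
          have h4 : 0 ≤ 1 - p (i : ZMod m) := by linarith
          rw [← ENNReal.ofReal_mul h1.le, ← ENNReal.ofReal_mul h4,
            ← ENNReal.ofReal_add (by positivity) (by positivity),
            ← ENNReal.ofReal_mul (Real.exp_pos _).le]
          refine ENNReal.ofReal_le_ofReal ?_
          have h5 : ∀ j, Real.exp (θ * (W j - W (S 0 ω) - (n + 1 : ℕ) * c)) =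
              Real.exp (θ * (W j - W i - c)) *
                Real.exp (θ * (W i - W (S 0 ω) - n * c)) := by
            intro j
            rw [← Real.exp_add]
            congr 1
            push_cast
            ring
          rw [h5, h5, ← mul_assoc, ← mul_assoc, ← add_mul]
          exact mul_le_mul_of_nonneg_right h3 (Real.exp_pos _).le
      _ = ENNReal.ofReal (Real.exp (θ ^ 2 * K ^ 2)) *
          ∫⁻ ω, ENNReal.ofReal (Real.exp (θ * (W (S n ω) - W (S 0 ω) - n * c))) ∂P :=
          lintegral_const_mul' _ _ ENNReal.ofReal_ne_top
      _ ≤ ENNReal.ofReal (Real.exp (θ ^ 2 * K ^ 2)) *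
          ENNReal.ofReal (Real.exp (n * (θ ^ 2 * K ^ 2))) := by gcongr
      _ = _ := by
          rw [← ENNReal.ofReal_mul (Real.exp_pos _).le, ← Real.exp_add]
          congr 2
          push_cast
          ring

/-- Chernoff's bound makes the exceptional probabilities geometrically small, so Borel–Cantelli
applies. -/
theorem IsGame.ae_eventually_lt {m : ℕ} {p : ZMod m → ℝ} (hp : ∀ i, 0 < p i ∧ p i < 1)
    {Ω : Type*} [MeasurableSpace Ω] {P : Measure Ω} [IsProbabilityMeasure P]
    {S : ℕ → Ω → ℤ} (hS : IsGame m p P S) {W : ℤ → ℝ} {c K : ℝ}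
    (hmean : ∀ i : ℤ, p i * (W (i + 1) - W i - c) + (1 - p i) * (W (i - 1) - W i - c) = 0)
    (hup : ∀ i, |W (i + 1) - W i - c| ≤ K) (hdown : ∀ i, |W (i - 1) - W i - c| ≤ K)
    (hK : 0 < K) {ε : ℝ} (hε : 0 < ε) :
    ∀ᵐ ω ∂P, ∀ᶠ n : ℕ in atTop, W (S n ω) - W (S 0 ω) - n * c < n * ε := by
  -- `θ * K ≤ 1` allows the exponential moment bound; `θ * K ^ 2 < ε` makes the rate `r` below
  -- negative.
  obtain ⟨θ, hθ, hθK, hθε⟩ : ∃ θ : ℝ, 0 < θ ∧ θ * K ≤ 1 ∧ θ * K ^ 2 < ε := by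
    refine ⟨min (1 / K) (ε / (2 * K ^ 2)), by positivity, ?_, ?_⟩
    · calc _ ≤ 1 / K * K := mul_le_mul_of_nonneg_right (min_le_left _ _) hK.le
        _ = 1 := by field_simp
    · calc _ ≤ ε / (2 * K ^ 2) * K ^ 2 :=
            mul_le_mul_of_nonneg_right (min_le_right _ _) (by positivity)
        _ = ε / 2 := by field_simp
        _ < ε := by linarith
  set r : ℝ := θ ^ 2 * K ^ 2 - θ * ε with hr
  have hr0 : r < 0 := by
    have : r = θ * (θ * K ^ 2 - ε) := by rw [hr]; ring
    rw [this]
    exact mul_neg_of_pos_of_neg hθ (by linarith)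
  have hbound : ∀ n : ℕ, P {ω | n * ε ≤ W (S n ω) - W (S 0 ω) - n * c} ≤
      ENNReal.ofReal (Real.exp r ^ n) := by
    intro n
    have hmeas : AEMeasurable (fun ω => ENNReal.ofReal
        (Real.exp (θ * (W (S n ω) - W (S 0 ω) - n * c)))) P := by
      have h1 : ∀ k, Measurable fun ω => W (S k ω) := fun k =>
        (measurable_of_countable W).comp (hS.measurable k)
      have h2 := h1 n
      have h3 := h1 0
      exact ((((h2.sub h3).sub_const _).const_mul θ).exp.ennreal_ofReal).aemeasurable
    have h := meas_ge_le_lintegral_div hmeas (ε := ENNReal.ofReal (Real.exp (θ * (n * ε))))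
      (by simp [Real.exp_pos]) ENNReal.ofReal_ne_top
    refine (measure_mono ?_).trans (h.trans ?_)
    · intro ω hω
      exact ENNReal.ofReal_le_ofReal
        (Real.exp_le_exp.mpr (mul_le_mul_of_nonneg_left hω hθ.le))
    · refine (ENNReal.div_le_div_right
        (hS.lintegral_exp_le hp hmean hup hdown hθ.le hθK n) _).trans (le_of_eq ?_)
      rw [← ENNReal.ofReal_div_of_pos (Real.exp_pos _), ← Real.exp_sub, ← Real.exp_nat_mul]
      congr 2
      rw [hr]
      ring
  have hsum : ∑' n : ℕ, P {ω | n * ε ≤ W (S n ω) - W (S 0 ω) - n * c} ≠ ⊤ := by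
    have hs : Summable fun n : ℕ => Real.exp r ^ n :=
      summable_geometric_of_lt_one (Real.exp_pos _).le (Real.exp_lt_one_iff.mpr hr0)
    exact ne_top_of_le_ne_top hs.tsum_ofReal_ne_top (ENNReal.tsum_le_tsum hbound)
  filter_upwards [ae_eventually_notMem hsum] with ω hω
  filter_upwards [hω] with n hn
  simpa using hn

/-- Law of large numbers for the martingale `W (S n) - W (S 0) - n c`. -/
theorem IsGame.ae_tendsto_div {m : ℕ} {p : ZMod m → ℝ} (hp : ∀ i, 0 < p i ∧ p i < 1)
    {Ω : Type*} [MeasurableSpace Ω] {P : Measure Ω} [IsProbabilityMeasure P]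
    {S : ℕ → Ω → ℤ} (hS : IsGame m p P S) {W : ℤ → ℝ} {c K : ℝ}
    (hmean : ∀ i : ℤ, p i * (W (i + 1) - W i - c) + (1 - p i) * (W (i - 1) - W i - c) = 0)
    (hup : ∀ i, |W (i + 1) - W i - c| ≤ K) (hdown : ∀ i, |W (i - 1) - W i - c| ≤ K)
    (hK : 0 < K) :
    ∀ᵐ ω ∂P, Tendsto (fun n : ℕ => (W (S n ω) - W (S 0 ω) - n * c) / n) atTop (𝓝 0) := by
  have h1 : ∀ᵐ ω ∂P, ∀ k : ℕ, ∀ᶠ n : ℕ in atTop,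
      W (S n ω) - W (S 0 ω) - n * c < n * (1 / ((k : ℝ) + 1)) :=
    ae_all_iff.mpr fun k => hS.ae_eventually_lt hp hmean hup hdown hK Nat.one_div_pos_of_nat
  have h2 : ∀ᵐ ω ∂P, ∀ k : ℕ, ∀ᶠ n : ℕ in atTop,
      -W (S n ω) - -W (S 0 ω) - n * -c < n * (1 / ((k : ℝ) + 1)) := by
    -- The lower bound is the upper bound for `-W` and `-c`.
    refine ae_all_iff.mpr fun k => hS.ae_eventually_lt (W := fun i => -W i) (c := -c) hp
      (fun i => by linear_combination -(hmean i)) (fun i => ?_) (fun i => ?_) hK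
      Nat.one_div_pos_of_nat
    · rw [← abs_neg]
      convert hup i using 2
      ring
    · rw [← abs_neg]
      convert hdown i using 2
      ring
  filter_upwards [h1, h2] with ω hω1 hω2
  rw [Metric.tendsto_atTop']
  intro ε hε
  obtain ⟨k, hk⟩ := exists_nat_one_div_lt hε
  obtain ⟨N, hN⟩ := eventually_atTop.mp ((hω1 k).and (hω2 k))
  refine ⟨N, fun n hn => ?_⟩
  obtain ⟨h3, h4⟩ := hN n hn.le
  have hn0 : (0 : ℝ) < n := Nat.cast_pos.mpr (by omega)
  refine lt_trans ?_ hk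
  rw [Real.dist_eq, sub_zero, abs_div, abs_of_pos hn0, div_lt_iff₀ hn0, abs_lt]
  constructor <;> linarith

theorem IsGame.ae_tendsto_speed {m : ℕ} [NeZero m] {p : ZMod m → ℝ}
    (hp : ∀ i, 0 < p i ∧ p i < 1)
    {Ω : Type*} [MeasurableSpace Ω] {P : Measure Ω} [IsProbabilityMeasure P]
    {S : ℕ → Ω → ℤ} (hS : IsGame m p P S) {v : ZMod m → ℝ}
    (hv : IsStationaryVector (cyclicChain m p) v) :
    ∀ᵐ ω ∂P, Tendsto (fun n : ℕ => (S n ω : ℝ) / (n : ℝ)) atTop (𝓝 (v ⬝ᵥ meanGain m p)) := by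
  obtain ⟨h, hh⟩ := exists_poisson_solution hp hv (meanGain m p)
  set c := v ⬝ᵥ meanGain m p
  obtain ⟨a, ha⟩ := Finite.exists_max fun i => |h i|
  set H := |h a|
  have hH : ∀ i, -H ≤ h i ∧ h i ≤ H := fun i => abs_le.mp (ha i)
  have hH0 : 0 ≤ H := abs_nonneg _
  have hc := abs_le.mp (le_refl |c|)
  have hc0 := abs_nonneg c
  have hlim := hS.ae_tendsto_div hp (W := fun i : ℤ => (i : ℝ) + h i) (c := c)
    (K := 1 + 2 * H + |c|) (fun i => ?_) (fun i => ?_) (fun i => ?_) (by positivity)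
  · filter_upwards [hlim] with ω hω
    -- The difference between the martingale and `S n - n * c` is bounded in `n` for each fixed `ω`,
    -- even if `S 0` is unbounded.
    have hb : Tendsto (fun n : ℕ => (h (S n ω : ZMod m) - (S 0 ω : ℝ) - h (S 0 ω : ZMod m)) /
        (n : ℝ)) atTop (𝓝 0) := by
      refine squeeze_zero_norm (a := fun n : ℕ => (2 * H + |(S 0 ω : ℝ)|) / (n : ℝ))
        (fun n => ?_) (tendsto_const_div_atTop_nhds_zero_nat _)
      rw [norm_div, Real.norm_natCast, Real.norm_eq_abs]
      refine div_le_div_of_nonneg_right ?_ (Nat.cast_nonneg n)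
      have h1 := hH (S n ω : ZMod m)
      have h2 := hH (S 0 ω : ZMod m)
      have h3 := abs_le.mp (le_refl |(S 0 ω : ℝ)|)
      rw [abs_le]
      constructor <;> linarith
    have hfin := (hω.sub hb).add_const c
    rw [sub_zero, zero_add] at hfin
    refine hfin.congr' ?_
    filter_upwards [eventually_gt_atTop 0] with n hn
    have hn0 : (n : ℝ) ≠ 0 := Nat.cast_ne_zero.mpr hn.ne'
    field_simp
    ring
  · have h1 := hh (i : ZMod m)
    simp only [meanGain] at h1
    push_cast
    linear_combination -h1
  · have h1 := hH ((i : ZMod m) + 1)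
    have h2 := hH (i : ZMod m)
    push_cast
    rw [abs_le]
    constructor <;> linarith
  · have h1 := hH ((i : ZMod m) - 1)
    have h2 := hH (i : ZMod m)
    push_cast
    rw [abs_le]
    constructor <;> linarith

theorem theorem5p1 (m : ℕ) [NeZero m] (p : ZMod m → ℝ)
    (hp : ∀ i, 0 < p i ∧ p i < 1)
    {Ω : Type*} [MeasurableSpace Ω] (P : Measure Ω) [IsProbabilityMeasure P]
    (S : ℕ → Ω → ℤ) (hS : IsGame m p P S) :
    0 < ∑ i, diagCofactor m p i ∧
    ∃ stat : ZMod m → ℝ,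
      IsStationaryVector (cyclicChain m p) stat ∧
      (∀ v, IsStationaryVector (cyclicChain m p) v → v = stat) ∧
      (∀ i, stat i = diagCofactor m p i / ∑ k, diagCofactor m p k) ∧
      (∀ᵐ ω ∂P, Tendsto (fun n : ℕ => (S n ω : ℝ) / (n : ℝ)) atTop
        (𝓝 (stat ⬝ᵥ meanGain m p))) ∧
      stat ⬝ᵥ meanGain m p =
        (1 / ∑ k, diagCofactor m p k) * ∑ i, diagCofactor m p i * (p i - (1 - p i)) := by
  have hstat := isStationaryVector_diagCofactor_div hp
  refine ⟨Finset.sum_pos (fun i _ => diagCofactor_pos hp i) Finset.univ_nonempty, _, hstat,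
    fun v hv => hv.eq_of_cyclicChain hp hstat, fun i => rfl, hS.ae_tendsto_speed hp hstat, ?_⟩
  rw [dotProduct, Finset.mul_sum]
  refine Finset.sum_congr rfl fun i _ => ?_
  rw [meanGain]
  ring
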